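/- Let $\mathcal H$ be a real Hilbert space. For $a,b\in\mathcal H$ put $\angle(a,b)=\arccos\frac{\langle a,b\rangle}{\|a\|\,\|b\|}$ if $a\neq 0$ and $b\neq 0$, and $\angle(a,b)=0$ otherwise. The scaled relative graph of a (possibly multi-valued) operator $A$ on $\mathcal H$, which maps each $x\in\mathcal H$ to a subset $Ax\subseteq\mathcal H$, is the subset of the extended complex plane $\overline{\mathbb C}=\mathbb C\cup\{\infty\}$ $$\mathcal G(A)=\left\{\frac{\|u-v\|}{\|x-y\|}\exp\left[\pm i\,\angle(u-v,x-y)\right]\;\middle|\; u\in Ax,\ v\in Ay,\ x\neq y\right\},$$ together with the point $\infty$ if (and only if) $A$ is multi-valued, that is, $Ax$ has at least two elements for some $x$. **Theorem.** Let $n=1$ or $n\ge 3$, and let $A\in\mathbb R^{n\times n}$, regarded as the single-valued operator $x\mapsto Ax$ on $\mathbb R^n$ with the Euclidean inner product. Let $\Lambda(A)\subseteq\mathbb C$ be the set of all (real and non-real) eigenvalues of $A$. Then $\Lambda(A)\subseteq\mathcal G(A)$. -/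

import Mathlib

namespace SRG

open scoped RealInnerProductSpace

/-- A multi-valued operator on `H`: every point is sent to a (possibly empty) subset of `H`. -/
abbrev Operator (H : Type*) := H → Set H

noncomputable section

/-- The angle between two vectors, in `[0, π]`, equal to `0` if one of the vectors vanishes. -/
def angle {H : Type*} [NormedAddCommGroup H] [InnerProductSpace ℝ H] (a b : H) : ℝ :=
  open Classical in
  if a ≠ 0 ∧ b ≠ 0 then Real.arccos (⟪a, b⟫ / (‖a‖ * ‖b‖)) else 0

/-- `A` is multi-valued if some point has at least two distinct images. -/
def IsMultiValued {H : Type*} (A : Operator H) : Prop :=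
  ∃ x, ∃ u ∈ A x, ∃ v ∈ A x, u ≠ v

/-- The finite points of the scaled relative graph: both numbers
`(‖u - v‖ / ‖x - y‖) exp (± i ∠(u - v, x - y))`, for all `u ∈ A x`, `v ∈ A y` with `x ≠ y`. -/
def finitePart {H : Type*} [NormedAddCommGroup H] [InnerProductSpace ℝ H]
    (A : Operator H) : Set ℂ :=
  {z | ∃ x y u v : H, u ∈ A x ∧ v ∈ A y ∧ x ≠ y ∧
    (z = ((‖u - v‖ / ‖x - y‖ : ℝ) : ℂ) * Complex.exp (Complex.I * (angle (u - v) (x - y) : ℂ)) ∨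
     z = ((‖u - v‖ / ‖x - y‖ : ℝ) : ℂ) *
      Complex.exp (-(Complex.I * (angle (u - v) (x - y) : ℂ))))}

/-- The scaled relative graph of `A`, a subset of the extended complex plane `ℂ ∪ {∞}`:
the point `∞` is added exactly when `A` is multi-valued. -/
def scaledRelativeGraph {H : Type*} [NormedAddCommGroup H] [InnerProductSpace ℝ H]
    (A : Operator H) : Set (OnePoint ℂ) :=
  ((↑) : ℂ → OnePoint ℂ) '' finitePart A ∪ {w | w = OnePoint.infty ∧ IsMultiValued A}

/-- The single-valued operator `x ↦ A x` on Euclidean space `ℝⁿ` given by a real matrix `A`. -/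
def matrixOperator {n : ℕ} (A : Matrix (Fin n) (Fin n) ℝ) :
    Operator (EuclideanSpace ℝ (Fin n)) :=
  fun x => {Matrix.toEuclideanLin A x}

/-- The set of all complex (real and non-real) eigenvalues of a real square matrix. -/
def eigenvalues {n : ℕ} (A : Matrix (Fin n) (Fin n) ℝ) : Set ℂ :=
  {z | Module.End.HasEigenvalue (Matrix.toLin' (A.map Complex.ofReal)) z}

end

end SRG

open scoped RealInnerProductSpace

namespace SRG

open Module

/-! Let `T` be the operator and `u + iv` an eigenvector for `z`. Testing the graph on a pair `x`,
`0`, it suffices to find a real `x ≠ 0` with `⟪T x, x⟫ = z.re * ‖x‖ ^ 2` and `‖T x‖ = ‖z‖ * ‖x‖`,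
that is, a common zero of two quadratic forms. The eigenvalue equation makes the values of each form
at `u` and `v` sum to zero, and `exists_common_isotropic` turns this into a single common zero. That
step needs odd dimension, where the pencil of the two forms has a degenerate member; hence the
restriction to an odd-dimensional subspace containing `u` and `v`, which may not exist when `n = 2`.
-/

/-- The pencil spanned by two bilinear forms on a real space of odd dimension contains a
degenerate form. -/
lemma exists_degenerate_rotation {V : Type*} [AddCommGroup V] [Module ℝ V]
    [FiniteDimensional ℝ V] (hV : Odd (finrank ℝ V)) (B C : LinearMap.BilinForm ℝ V) :
    ∃ θ : ℝ, ∃ e : V, e ≠ 0 ∧ ∀ x, Real.cos θ * B x e + Real.sin θ * C x e = 0 := by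
  classical
  let b := finBasis ℝ V
  let f : ℝ → ℝ := fun θ =>
    (Real.cos θ • LinearMap.BilinForm.toMatrix b B +
      Real.sin θ • LinearMap.BilinForm.toMatrix b C).det
  have hf : Continuous f := by
    refine Continuous.matrix_det ?_
    fun_prop
  -- A half turn negates the matrix, and in odd dimension also its determinant, so `f` must vanish
  -- somewhere.
  have hpi : f Real.pi = -f 0 := by
    simp only [f, Real.cos_pi, Real.sin_pi, Real.cos_zero, Real.sin_zero, zero_smul, add_zero,
      neg_smul, one_smul, Matrix.det_neg, Fintype.card_fin, hV.neg_one_pow, neg_one_mul]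
  obtain ⟨θ, hθ⟩ : ∃ θ, f θ = 0 := by
    rcases le_total (f 0) 0 with h | h
    · exact mem_range_of_exists_le_of_exists_ge hf ⟨0, h⟩ ⟨Real.pi, by linarith⟩
    · exact mem_range_of_exists_le_of_exists_ge hf ⟨Real.pi, by linarith⟩ ⟨0, h⟩
  obtain ⟨c, hc, hMc⟩ := Matrix.exists_mulVec_eq_zero_iff.mpr hθ
  refine ⟨θ, b.equivFun.symm c, b.equivFun.symm.map_ne_zero_iff.mpr hc, fun x => ?_⟩
  have key : ∀ D : LinearMap.BilinForm ℝ V,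
      D x (b.equivFun.symm c) = b.repr x ⬝ᵥ (LinearMap.BilinForm.toMatrix b D).mulVec c := by
    intro D
    rw [← Basis.equivFun_apply, LinearMap.BilinForm.dotProduct_toMatrix_mulVec,
      LinearEquiv.symm_apply_apply]
  rw [key, key, ← smul_eq_mul, ← smul_eq_mul, ← dotProduct_smul, ← dotProduct_smul,
    ← dotProduct_add, ← Matrix.smul_mulVec, ← Matrix.smul_mulVec, ← Matrix.add_mulVec, hMc,
    dotProduct_zero]

/-- If the quadratic forms of `B` and `C` have no common zero and the radical of `B` contains
`e`, then the quadratic form of `C` is positive on the zeros of that of `B`, provided it is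
positive at `e`. -/
lemma pos_of_isotropic {V : Type*} [AddCommGroup V] [Module ℝ V]
    {B C : LinearMap.BilinForm ℝ V} (hB : B.IsSymm) (hC : C.IsSymm)
    (h : ∀ x, B x x = 0 → C x x = 0 → x = 0) {e : V} (he : ∀ x, B x e = 0)
    (hCe : 0 < C e e) {p : V} (hp : p ≠ 0) (hBp : B p p = 0) : 0 < C p p := by
  have he' : ∀ x, B e x = 0 := fun x => by rw [hB.eq, he]
  by_contra! hle
  have hCs : C e p = C p e := hC.eq e p
  -- A quarter of the discriminant of `t ↦ C (p + t e) (p + t e)`.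
  let d := C p e ^ 2 - C e e * C p p
  have hd : 0 ≤ d := by nlinarith [mul_nonneg hCe.le (neg_nonneg.mpr hle), sq_nonneg (C p e)]
  -- a zero of `t ↦ C (p + t e) (p + t e)`
  let t := (-C p e + Real.sqrt d) / C e e
  have ht : C e e * t = -C p e + Real.sqrt d := by simp only [t]; field_simp
  have hz : C (p + t • e) (p + t • e) = 0 := by
    simp only [map_add, map_smul, LinearMap.add_apply, LinearMap.smul_apply, smul_eq_mul, hCs]
    have h1 : C e e * (C p p + t * C p e + t * (C p e + t * C e e)) = 0 := by
      linear_combination (C e e * t + Real.sqrt d + C p e) * ht + Real.sq_sqrt hd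
    exact (mul_eq_zero.mp h1).resolve_left hCe.ne'
  -- Adding multiples of the radical vector `e` keeps `p` isotropic for `B`, so `p` is forced to be
  -- a multiple of `e`, where `C` is positive.
  have hpe : p + t • e = 0 := h _ (by simp [he, he', hBp]) hz
  have hpt : p = -(t • e) := eq_neg_of_add_eq_zero_left hpe
  have ht0 : t ≠ 0 := by
    intro h0
    exact hp (by simpa [h0] using hpt)
  have : C p p = t ^ 2 * C e e := by
    rw [hpt]
    simp
    ring
  have : 0 < t ^ 2 * C e e := by positivity
  linarith

/-- Convexity of the joint range of two quadratic forms, at the origin: on a real space of odd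
dimension, if the values of two quadratic forms sum to zero over a pair of vectors, then they
have a common nontrivial zero. -/
lemma exists_common_isotropic {V : Type*} [AddCommGroup V] [Module ℝ V]
    [FiniteDimensional ℝ V] (hV : Odd (finrank ℝ V)) {B C : LinearMap.BilinForm ℝ V}
    (hB : B.IsSymm) (hC : C.IsSymm) {u v : V} (huv : u ≠ 0 ∨ v ≠ 0)
    (hBuv : B u u + B v v = 0) (hCuv : C u u + C v v = 0) :
    ∃ x, x ≠ 0 ∧ B x x = 0 ∧ C x x = 0 := by
  obtain ⟨θ, e, he0, he⟩ := exists_degenerate_rotation hV B C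
  by_contra! hno
  -- Rotating the pair of forms preserves common zeros and puts `e` in the radical of `P`.
  let P : LinearMap.BilinForm ℝ V := Real.cos θ • B + Real.sin θ • C
  let Q : LinearMap.BilinForm ℝ V := (-Real.sin θ) • B + Real.cos θ • C
  have hPa : ∀ x y, P x y = Real.cos θ * B x y + Real.sin θ * C x y := fun x y => rfl
  have hQa : ∀ x y, Q x y = -Real.sin θ * B x y + Real.cos θ * C x y := fun x y => rfl
  have hP : P.IsSymm := ⟨fun x y => by
    have h1 := hB.eq x y
    have h2 := hC.eq x y
    rw [hPa, hPa, h1, h2]⟩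
  have hQ : Q.IsSymm := ⟨fun x y => by
    have h1 := hB.eq x y
    have h2 := hC.eq x y
    rw [hQa, hQa, h1, h2]⟩
  have hPQ : ∀ x, P x x = 0 → Q x x = 0 → x = 0 := by
    intro x h1 h2
    rw [hPa] at h1
    rw [hQa] at h2
    have hs := Real.sin_sq_add_cos_sq θ
    by_contra hx
    refine hno x hx ?_ ?_
    · linear_combination Real.cos θ * h1 - Real.sin θ * h2 - B x x * hs
    · linear_combination Real.sin θ * h1 + Real.cos θ * h2 - C x x * hs
  have hPuv : P u u + P v v = 0 := by
    rw [hPa, hPa]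
    linear_combination Real.cos θ * hBuv + Real.sin θ * hCuv
  have hQuv : Q u u + Q v v = 0 := by
    rw [hQa, hQa]
    linear_combination (-Real.sin θ) * hBuv + Real.cos θ * hCuv
  have hPs : P v u = P u v := hP.eq v u
  -- rotate the pair `(u, v)` until both vectors are isotropic for `P`
  let g : ℝ → ℝ := fun t =>
    Real.cos t ^ 2 * P u u + 2 * (Real.cos t * Real.sin t) * P u v + Real.sin t ^ 2 * P v v
  have hg : Continuous g := by fun_prop
  have hg0 : g 0 = P u u := by simp [g]
  have hg1 : g (Real.pi / 2) = P v v := by simp [g]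
  obtain ⟨t, ht⟩ : ∃ t, g t = 0 := by
    rcases le_total (P u u) 0 with h | h
    · exact mem_range_of_exists_le_of_exists_ge hg ⟨0, by linarith⟩ ⟨Real.pi / 2, by linarith⟩
    · exact mem_range_of_exists_le_of_exists_ge hg ⟨Real.pi / 2, by linarith⟩ ⟨0, by linarith⟩
  have hs := Real.sin_sq_add_cos_sq t
  let p := Real.cos t • u + Real.sin t • v
  let q := (-Real.sin t) • u + Real.cos t • v
  have hPp : P p p = 0 := by
    rw [← ht]
    simp only [p, g, map_add, map_smul, LinearMap.add_apply, LinearMap.smul_apply, smul_eq_mul, hPs]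
    ring
  have hsum : ∀ D : LinearMap.BilinForm ℝ V, D p p + D q q = D u u + D v v := by
    intro D
    simp only [p, q, map_add, map_smul, LinearMap.add_apply, LinearMap.smul_apply, smul_eq_mul]
    linear_combination (D u u + D v v) * hs
  have hPq : P q q = 0 := by linarith [hsum P]
  have hQpq : Q p p + Q q q = 0 := by linarith [hsum Q]
  have hpq : p ≠ 0 ∨ q ≠ 0 := by
    by_contra! hpq
    have hu : u = Real.cos t • p - Real.sin t • q := by
      simp only [p, q]
      match_scalars
      · linear_combination -hs
      · ring
    have hv : v = Real.sin t • p + Real.cos t • q := by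
      simp only [p, q]
      match_scalars
      · linear_combination -hs
      · ring
    rw [hpq.1, hpq.2] at hu hv
    simp only [smul_zero, sub_zero, add_zero] at hu hv
    exact huv.elim (· hu) (· hv)
  have hPe : ∀ x, P x e = 0 := he
  have hQe : Q e e ≠ 0 := fun h => he0 (hPQ e (hPe e) h)
  -- `Q` has one strict sign on the nonzero `P`-isotropic vectors, which contradicts `Q p p + Q q q
  -- = 0`.
  rcases hQe.lt_or_gt with hneg | hpos
  · have key : ∀ x, x ≠ 0 → P x x = 0 → Q x x < 0 := by
      intro x hx hPx
      have := pos_of_isotropic (C := -Q) hP hQ.neg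
        (fun x h1 h2 => hPQ x h1 (by simpa using h2)) hPe (by simpa using hneg) hx hPx
      simpa using this
    rcases eq_or_ne p 0 with hp | hp
    · have := key q (hpq.resolve_left (· hp)) hPq
      simp [hp] at hQpq
      linarith
    · rcases eq_or_ne q 0 with hq | hq
      · have := key p hp hPp
        simp [hq] at hQpq
        linarith
      · linarith [key p hp hPp, key q hq hPq]
  · have key : ∀ x, x ≠ 0 → P x x = 0 → 0 < Q x x := fun x hx hPx =>
      pos_of_isotropic hP hQ hPQ hPe hpos hx hPx
    rcases eq_or_ne p 0 with hp | hp
    · have := key q (hpq.resolve_left (· hp)) hPq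
      simp [hp] at hQpq
      linarith
    · rcases eq_or_ne q 0 with hq | hq
      · have := key p hp hPp
        simp [hq] at hQpq
        linarith
      · linarith [key p hp hPp, key q hq hPq]

/-- In dimension one or at least three, any two vectors lie in an odd-dimensional subspace. -/
lemma exists_odd_finrank_submodule {E : Type*} [NormedAddCommGroup E] [InnerProductSpace ℝ E]
    [FiniteDimensional ℝ E] (hE : finrank ℝ E = 1 ∨ 3 ≤ finrank ℝ E) (u v : E) :
    ∃ V : Submodule ℝ E, Odd (finrank ℝ V) ∧ u ∈ V ∧ v ∈ V := by
  rcases Nat.even_or_odd (finrank ℝ E) with hev | hodd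
  · have h3 : 3 ≤ finrank ℝ E := by
      rcases hE with h | h
      · rw [h] at hev
        exact absurd hev (by decide)
      · exact h
    -- Some `w ≠ 0` is orthogonal to `u` and `v`; the hyperplane orthogonal to `w` has odd
    -- dimension.
    let S := Submodule.span ℝ ({u, v} : Set E)
    have hS : finrank ℝ S ≤ 2 := by
      classical
      have := finrank_span_finset_le_card (R := ℝ) ({u, v} : Finset E)
      rw [Finset.coe_pair] at this
      exact this.trans Finset.card_le_two
    have hSo : Sᗮ ≠ ⊥ := by
      intro h
      have := S.finrank_add_finrank_orthogonal
      rw [h, finrank_bot] at this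
      omega
    obtain ⟨w, hwS, hw⟩ := Submodule.exists_mem_ne_zero_of_ne_bot hSo
    have hfin := (Submodule.span ℝ {w}).finrank_add_finrank_orthogonal
    rw [finrank_span_singleton hw] at hfin
    refine ⟨(Submodule.span ℝ {w})ᗮ, ?_, ?_, ?_⟩
    · rw [← hfin] at hev
      by_contra h
      exact Nat.not_even_iff_odd.mpr (odd_one.add_even (Nat.not_odd_iff_even.mp h)) hev
    · exact Submodule.mem_orthogonal_singleton_iff_inner_left.mpr
        (hwS u (Submodule.subset_span (by simp)))
    · exact Submodule.mem_orthogonal_singleton_iff_inner_left.mpr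
        (hwS v (Submodule.subset_span (by simp)))
  · exact ⟨⊤, by rwa [finrank_top], Submodule.mem_top, Submodule.mem_top⟩

/-- A complex number with modulus `‖a‖ / ‖b‖` and real part `⟪a, b⟫ / ‖b‖ ^ 2` is one of the two
numbers `(‖a‖ / ‖b‖) exp (± i ∠(a, b))`. -/
lemma eq_norm_div_mul_exp_angle {H : Type*} [NormedAddCommGroup H] [InnerProductSpace ℝ H]
    {a b : H} (hb : b ≠ 0) {z : ℂ} (hre : ⟪a, b⟫ = z.re * ‖b‖ ^ 2)
    (hnorm : ‖a‖ = ‖z‖ * ‖b‖) :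
    z = ((‖a‖ / ‖b‖ : ℝ) : ℂ) * Complex.exp (Complex.I * (angle a b : ℂ)) ∨
      z = ((‖a‖ / ‖b‖ : ℝ) : ℂ) * Complex.exp (-(Complex.I * (angle a b : ℂ))) := by
  have hb' : ‖b‖ ≠ 0 := norm_ne_zero_iff.mpr hb
  rcases eq_or_ne z 0 with rfl | hz
  · left
    simp [show ‖a‖ = 0 by simpa using hnorm]
  have hz' : ‖z‖ ≠ 0 := norm_ne_zero_iff.mpr hz
  have ha : a ≠ 0 := by
    rw [← norm_ne_zero_iff, hnorm]
    exact mul_ne_zero hz' hb'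
  have hang : angle a b = Real.arccos (z.re / ‖z‖) := by
    rw [angle, if_pos ⟨ha, hb⟩, hre, hnorm]
    congr 1
    field_simp
  have hdiv : ‖a‖ / ‖b‖ = ‖z‖ := by rw [hnorm, mul_div_assoc, div_self hb', mul_one]
  rw [hang, hdiv]
  have hpolar := Complex.norm_mul_exp_arg_mul_I z
  -- The arccosine is `|arg z|`, so the sign of `z.im` selects the sign of the exponent.
  rcases le_or_gt 0 z.im with him | him
  · left
    rw [Complex.arg_of_im_nonneg_of_ne_zero him hz] at hpolar
    rw [mul_comm Complex.I]
    exact hpolar.symm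
  · right
    rw [Complex.arg_of_im_neg him] at hpolar
    rw [mul_comm Complex.I, ← neg_mul, ← Complex.ofReal_neg]
    exact hpolar.symm

/-- The real and imaginary parts of a complex eigenvector. -/
lemma exists_re_im_of_mem_eigenvalues {n : ℕ} {A : Matrix (Fin n) (Fin n) ℝ} {z : ℂ}
    (hz : z ∈ eigenvalues A) :
    ∃ u v : EuclideanSpace ℝ (Fin n), (u ≠ 0 ∨ v ≠ 0) ∧
      Matrix.toEuclideanLin A u = z.re • u - z.im • v ∧
      Matrix.toEuclideanLin A v = z.im • u + z.re • v := by
  obtain ⟨w, hw⟩ := Module.End.HasEigenvalue.exists_hasEigenvector hz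
  have heq : ∀ i, ∑ j, (A i j : ℂ) * w j = z * w i := fun i => by
    have := congrFun hw.apply_eq_smul i
    simpa [Matrix.toLin'_apply, Matrix.mulVec, dotProduct] using this
  refine ⟨WithLp.toLp 2 fun i => (w i).re, WithLp.toLp 2 fun i => (w i).im, ?_, ?_, ?_⟩
  · by_contra! h
    apply hw.2
    ext i
    have h1 := congrArg (fun x : EuclideanSpace ℝ (Fin n) => x i) h.1
    have h2 := congrArg (fun x : EuclideanSpace ℝ (Fin n) => x i) h.2
    exact Complex.ext (by simpa using h1) (by simpa using h2)
  · ext i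
    have := congrArg Complex.re (heq i)
    simpa [Matrix.mulVec, dotProduct] using this
  · ext i
    have := congrArg Complex.im (heq i)
    simpa [Matrix.mulVec, dotProduct, add_comm] using this

end SRG

open Module in
theorem theorem3p1 (n : ℕ) (hn : n = 1 ∨ 3 ≤ n) (A : Matrix (Fin n) (Fin n) ℝ) :
    ((↑) : ℂ → OnePoint ℂ) '' SRG.eigenvalues A ⊆
      SRG.scaledRelativeGraph (SRG.matrixOperator A) := by
  rintro _ ⟨z, hz, rfl⟩
  refine Or.inl ⟨z, ?_, rfl⟩
  obtain ⟨u, v, huv, hu, hv⟩ := SRG.exists_re_im_of_mem_eigenvalues hz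
  obtain ⟨V, hV, huV, hvV⟩ := SRG.exists_odd_finrank_submodule
    (by rwa [finrank_euclideanSpace_fin]) u v
  set T := Matrix.toEuclideanLin A
  let I : LinearMap.BilinForm ℝ (EuclideanSpace ℝ (Fin n)) := innerₗ _
  -- Symmetrizing `⟪T x, y⟫` doubles its diagonal, hence the factor 2 on `z.re`.
  let B : LinearMap.BilinForm ℝ V :=
    (I.compl₁₂ T LinearMap.id + I.compl₁₂ LinearMap.id T - (2 * z.re) • I).compl₁₂
      V.subtype V.subtype
  let C : LinearMap.BilinForm ℝ V :=
    (I.compl₁₂ T T - (‖z‖ ^ 2) • I).compl₁₂ V.subtype V.subtype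
  have hBa : ∀ x y : V, B x y = ⟪T x, y⟫ + ⟪(x : EuclideanSpace ℝ (Fin n)), T y⟫
      - 2 * z.re * ⟪(x : EuclideanSpace ℝ (Fin n)), y⟫ := fun x y => rfl
  have hCa : ∀ x y : V, C x y = ⟪T x, T y⟫
      - ‖z‖ ^ 2 * ⟪(x : EuclideanSpace ℝ (Fin n)), y⟫ := fun x y => rfl
  have hB : B.IsSymm := ⟨fun x y => by
    simp only [hBa]
    rw [real_inner_comm (T y), real_inner_comm (y : EuclideanSpace ℝ (Fin n)),
      real_inner_comm (y : EuclideanSpace ℝ (Fin n)) x]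
    ring⟩
  have hC : C.IsSymm := ⟨fun x y => by
    simp only [hCa]
    rw [real_inner_comm (T y), real_inner_comm (y : EuclideanSpace ℝ (Fin n)) x]⟩
  have hnz : ‖z‖ ^ 2 = z.re ^ 2 + z.im ^ 2 := by
    rw [Complex.sq_norm, Complex.normSq_apply]
    ring
  obtain ⟨x, hx, hBx, hCx⟩ := SRG.exists_common_isotropic hV hB hC
    (u := ⟨u, huV⟩) (v := ⟨v, hvV⟩) (by simpa [Submodule.mk_eq_zero] using huv)
    (by
      simp only [hBa, hu, hv, inner_add_left, inner_add_right, inner_sub_left, inner_sub_right,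
        real_inner_smul_left, real_inner_smul_right, real_inner_comm u v]
      ring)
    (by
      simp only [hCa, hu, hv, hnz, inner_add_left, inner_add_right, inner_sub_left,
        inner_sub_right, real_inner_smul_left, real_inner_smul_right, real_inner_comm u v]
      ring)
  rw [hBa, real_inner_comm (T x), real_inner_self_eq_norm_sq] at hBx
  rw [hCa, real_inner_self_eq_norm_sq, real_inner_self_eq_norm_sq] at hCx
  have hx0 : (x : EuclideanSpace ℝ (Fin n)) ≠ 0 := by simpa using hx
  refine ⟨x, 0, T x, 0, rfl, by simp [SRG.matrixOperator], hx0, ?_⟩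
  rw [sub_zero, sub_zero]
  refine SRG.eq_norm_div_mul_exp_angle hx0 (by linarith) ?_
  rw [← sq_eq_sq₀ (norm_nonneg _) (by positivity), mul_pow]
  linarith
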